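/- For an integer $n$ let $t_n = n(n+1)/2$ denote the $n$-th triangular number. A non-negative integer $N$ can be represented in the form $$N = l^2 + m^2 + 4t_n \qquad (l, m, n \in \mathbb{Z})$$ if and only if $N$ is not of the form $4k+3$ with $k$ a non-negative integer. -/

import Mathlib

/-- The triangular number `t_n = n (n + 1) / 2`, for any integer index `n`.
The division is exact, see `two_mul_triangularNumber`. -/
def triangularNumber (n : ℤ) : ℤ := n * (n + 1) / 2

theorem two_mul_triangularNumber (n : ℤ) : 2 * triangularNumber n = n * (n + 1) :=
  Int.mul_ediv_cancel' (Int.even_mul_succ_self n).two_dvd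

/-!
The representation `N = l² + m² + 4 tₙ` amounts to
`2 N + 1 = (l + m)² + (l - m)² + (2 n + 1)²`, so the claim is that the odd number `2 N + 1` is a sum
of three squares if and only if it is not `7` modulo `8`. Necessity is a congruence.

Sufficiency is Legendre's three-square theorem for odd numbers, by Dirichlet's argument.

* `UnimodularTernary.sum_three_sq`: a positive definite integral ternary form of determinant `1`
  represents only sums of three squares. By descent one reaches a form that is reduced in the sense
  of Hermite: its leading coefficient is small compared with the leading minor, and conversely. Both
  are then `1`, and completing squares turns the form into `X² + Y² + Z²`.
* `exists_prime_mul_eq_two_mul_add_one`: for odd `s` not `7` modulo `8`, Dirichlet's theorem on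
  primes in arithmetic progressions gives a prime `p` and a number `b` with `b * s = 2 * p + 1`, in
  residue classes for which the Jacobi symbol `(-b / p)` is `1` by quadratic reciprocity
  (`isSquare_neg_of_mul_eq_two_mul_add_one`).
* Writing `r² + b = 2 * p * a`, the form with matrix `!![a, r, 1; r, 2 * p, 0; 1, 0, s]` has
  determinant `1` and represents `s` at `(0, 0, 1)`.
-/

/-! ### Positive definite ternary forms of determinant one -/

/-- The integral ternary form
`a x² + b y² + c z² + 2 d y z + 2 e x z + 2 f x y`, with symmetric matrix
`!![a, f, e; f, b, d; e, d, c]`, is positive definite of determinant `1` (the leading principal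
minors are `a`, `a * b - f ^ 2` and the determinant) and represents the integer `s`. -/
structure UnimodularTernary (s a b c d e f : ℤ) : Prop where
  pos : 0 < a
  minor_pos : 0 < a * b - f ^ 2
  det_eq : a * b * c + 2 * d * e * f - a * d ^ 2 - b * e ^ 2 - c * f ^ 2 = 1
  represents : ∃ x y z : ℤ,
    a * x ^ 2 + b * y ^ 2 + c * z ^ 2 + 2 * d * y * z + 2 * e * x * z + 2 * f * x * y = s

namespace UnimodularTernary

variable {s a b c d e f : ℤ}

/-- The determinant identity for the binary form complementary to `x`: multiplied by `a`, the form
is `(a x + f y + e z)²` plus the binary form in `y, z` with coefficients `a * b - f ^ 2`,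
`a * c - e ^ 2` and `2 * (a * d - e * f)`, whose determinant is `a`. -/
theorem minor_mul_minor (h : UnimodularTernary s a b c d e f) :
    (a * b - f ^ 2) * (a * c - e ^ 2) - (a * d - e * f) ^ 2 = a := by
  linear_combination a * h.det_eq

/-- The substitution `x ↦ x + k y`. -/
theorem shift_x (h : UnimodularTernary s a b c d e f) (k : ℤ) :
    UnimodularTernary s a (b + 2 * k * f + k ^ 2 * a) c (d + k * e) e (f + k * a) where
  pos := h.pos
  minor_pos := by linarith [h.minor_pos,
    show a * (b + 2 * k * f + k ^ 2 * a) - (f + k * a) ^ 2 = a * b - f ^ 2 by ring]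
  det_eq := by linear_combination h.det_eq
  represents := by
    obtain ⟨x, y, z, hs⟩ := h.represents
    exact ⟨x - k * y, y, z, by linear_combination hs⟩

/-- The substitution `y ↦ y + k z`. -/
theorem shift_y (h : UnimodularTernary s a b c d e f) (k : ℤ) :
    UnimodularTernary s a b (c + 2 * k * d + k ^ 2 * b) (d + k * b) (e + k * f) f where
  pos := h.pos
  minor_pos := h.minor_pos
  det_eq := by linear_combination h.det_eq
  represents := by
    obtain ⟨x, y, z, hs⟩ := h.represents
    exact ⟨x, y - k * z, z, by linear_combination hs⟩

theorem swap_xy (h : UnimodularTernary s a b c d e f) : UnimodularTernary s b a c e d f where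
  pos := by nlinarith [h.pos, h.minor_pos]
  minor_pos := by linarith [h.minor_pos]
  det_eq := by linear_combination h.det_eq
  represents := by
    obtain ⟨x, y, z, hs⟩ := h.represents
    exact ⟨y, x, z, by linear_combination hs⟩

theorem swap_yz (h : UnimodularTernary s a b c d e f) : UnimodularTernary s a c b d f e where
  pos := h.pos
  minor_pos := by nlinarith [h.pos, h.minor_pos, h.minor_mul_minor, sq_nonneg (a * d - e * f)]
  det_eq := by linear_combination h.det_eq
  represents := by
    obtain ⟨x, y, z, hs⟩ := h.represents
    exact ⟨x, z, y, by linear_combination hs⟩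

theorem sum_three_sq_of_eq_one (h : UnimodularTernary s 1 b c d e f) (hm : 1 * b - f ^ 2 = 1) :
    ∃ x y z : ℤ, x ^ 2 + y ^ 2 + z ^ 2 = s := by
  obtain ⟨x, y, z, hs⟩ := h.represents
  have hdet := h.minor_mul_minor
  rw [hm] at hdet
  exact ⟨x + f * y + e * z, y + (d - e * f) * z, z,
    by linear_combination hs - z ^ 2 * hdet - y ^ 2 * hm⟩

end UnimodularTernary

theorem exists_four_mul_sq_add_mul_le {m : ℤ} (hm : 0 < m) (g : ℤ) :
    ∃ k : ℤ, 4 * (g + k * m) ^ 2 ≤ m ^ 2 := by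
  refine ⟨-((2 * g + m) / (2 * m)), ?_⟩
  have h0 := Int.emod_nonneg (2 * g + m) (show 2 * m ≠ 0 by positivity)
  have h1 := Int.emod_lt_of_pos (2 * g + m) (show 0 < 2 * m by positivity)
  have h2 := Int.mul_ediv_add_emod (2 * g + m) (2 * m)
  set q := (2 * g + m) / (2 * m)
  set r := (2 * g + m) % (2 * m)
  nlinarith [show 2 * (g + -q * m) = r - m by linear_combination -h2]

/-- The inequalities satisfied by a reduced form (`m` is its leading minor) leave only
`a = m = 1`. -/
theorem eq_one_of_reduced {a m : ℤ} (ha : 0 < a) (hm : 0 < m) (h₁ : 3 * m ^ 2 ≤ 4 * a)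
    (h₂ : 3 * a ^ 2 ≤ 4 * m) : a = 1 ∧ m = 1 := by
  have ha1 : a = 1 := by
    by_contra hne
    have : 2 ≤ a := by omega
    have : 3 ≤ m := by nlinarith
    nlinarith
  subst ha1
  exact ⟨rfl, by nlinarith⟩

/-- Descent on the pair (leading coefficient, leading minor), ordered lexicographically. -/
theorem UnimodularTernary.sum_three_sq {s a b c d e f : ℤ} (h : UnimodularTernary s a b c d e f) :
    ∃ x y z : ℤ, x ^ 2 + y ^ 2 + z ^ 2 = s := by
  obtain ⟨k, hk⟩ := exists_four_mul_sq_add_mul_le h.minor_pos (a * d - e * f)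
  have h' := h.shift_y k
  by_cases hyz : a * (c + 2 * k * d + k ^ 2 * b) - (e + k * f) ^ 2 < a * b - f ^ 2
  · exact h'.swap_yz.sum_three_sq
  obtain ⟨j, hj⟩ := exists_four_mul_sq_add_mul_le h.pos f
  have h'' := h'.shift_x j
  by_cases hxy : b + 2 * j * f + j ^ 2 * a < a
  · exact h''.swap_xy.sum_three_sq
  have hdet := h'.minor_mul_minor
  rw [show a * (d + k * b) - (e + k * f) * f = a * d - e * f + k * (a * b - f ^ 2) by ring] at hdet
  have hminor : a * (b + 2 * j * f + j ^ 2 * a) - (f + j * a) ^ 2 = a * b - f ^ 2 := by ring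
  have := h.pos
  have := h.minor_pos
  obtain ⟨rfl, hm⟩ := eq_one_of_reduced h.pos h.minor_pos (by nlinarith) (by nlinarith)
  exact h''.sum_three_sq_of_eq_one (hminor.trans hm)
termination_by (a.toNat, (a * b - f ^ 2).toNat)
decreasing_by
  · have := h.minor_pos
    exact Prod.Lex.right _ (by omega)
  · have := h.pos
    exact Prod.Lex.left _ _ (by omega)

/-! ### The three-square theorem for odd numbers -/

open NumberTheorySymbols in
/-- By quadratic reciprocity `(-b / p) = (p / b)`, which equals `(-2 / b)` because
`-2 * p ≡ 1 [ZMOD b]`; and `(-2 / b) = 1` because `b` is `1` or `3` modulo `8`. -/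
theorem isSquare_neg_of_mul_eq_two_mul_add_one {b p s : ℕ} (hp : p.Prime)
    (hbs : b * s = 2 * p + 1) (hb : b % 8 = 1 ∨ b % 8 = 3)
    (hpb : p % 4 = 1 ∨ p % 4 = 3 ∧ b % 4 = 3) : IsSquare ((-b : ℤ) : ZMod p) := by
  have := Fact.mk hp
  have hbo : Odd b := Nat.odd_iff.mpr (by omega)
  have hpo : Odd p := Nat.odd_iff.mpr (by omega)
  have h2 : J(-2 | b) = 1 := by
    rw [jacobiSym.at_neg_two hbo, ZMod.χ₈'_nat_eq_if_mod_eight, if_neg (by omega), if_pos hb]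
  have hbs' : (b * s : ℤ) = 2 * p + 1 := mod_cast hbs
  have hJ : J(-2 * p | b) = 1 := by
    rw [← jacobiSym.one_left b]
    refine jacobiSym.mod_left' (Int.ModEq.symm (Int.modEq_iff_dvd.mpr ⟨-s, ?_⟩))
    linear_combination hbs'
  rw [jacobiSym.mul_left, h2, one_mul] at hJ
  apply ZMod.isSquare_of_jacobiSym_eq_one
  rw [jacobiSym.neg _ hpo]
  rcases hpb with hp1 | ⟨hp3, hb3⟩
  · rw [ZMod.χ₄_nat_one_mod_four hp1, one_mul,
      ← jacobiSym.quadratic_reciprocity_one_mod_four hp1 hbo, hJ]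
  · rw [ZMod.χ₄_nat_three_mod_four hp3,
      jacobiSym.quadratic_reciprocity_three_mod_four hb3 hp3, hJ]
    norm_num

theorem exists_prime_mul_eq_two_mul_add_one {s : ℕ} (hs : s % 8 = 1 ∨ s % 8 = 3 ∨ s % 8 = 5) :
    ∃ p b : ℕ, p.Prime ∧ b * s = 2 * p + 1 ∧ p % 2 = 1 ∧ b % 2 = 1 ∧ IsSquare ((-b : ℤ) : ZMod p) := by
  -- `p` is sought in the class of `r` modulo `4 * s`; then `b = k + 8 * v`.
  obtain ⟨k, r, hr, hro, hk⟩ : ∃ k r : ℕ, k * s = 2 * r + 1 ∧ r % 2 = 1 ∧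
      (k = 1 ∧ r % 4 = 1 ∨ k = 3) := by
    rcases hs with h | h | h
    · exact ⟨3, (3 * s - 1) / 2, by omega, by omega, by omega⟩
    · exact ⟨1, (s - 1) / 2, by omega, by omega, by omega⟩
    · exact ⟨3, (3 * s - 1) / 2, by omega, by omega, by omega⟩
  have hrs : r.Coprime s := by
    rw [← Nat.isCoprime_iff_coprime]
    exact ⟨-2, k, by linarith [show (k * s : ℤ) = 2 * r + 1 from mod_cast hr]⟩
  have hr4 : r.Coprime 4 :=
    Nat.Coprime.pow_right 2 (Nat.coprime_two_right.mpr (Nat.odd_iff.mpr hro))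
  obtain ⟨p, hpr, hp, hmod⟩ := Nat.forall_exists_prime_gt_and_modEq r
    (show 4 * s ≠ 0 by omega) (hr4.mul_right hrs)
  obtain ⟨v, hv⟩ := (Nat.modEq_iff_dvd' hpr.le).mp hmod.symm
  have hpv : p = r + 4 * (s * v) := by rw [← mul_assoc]; omega
  have hbs : (k + 8 * v) * s = 2 * p + 1 := by rw [hpv]; linarith
  refine ⟨p, k + 8 * v, hp, hbs, by omega, by omega,
    isSquare_neg_of_mul_eq_two_mul_add_one hp hbs (by omega) (by omega)⟩

theorem sum_three_sq_of_odd {s : ℕ} (hs : s % 8 = 1 ∨ s % 8 = 3 ∨ s % 8 = 5) :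
    ∃ x y z : ℤ, x ^ 2 + y ^ 2 + z ^ 2 = s := by
  obtain ⟨p, b, hp, hbs, hp2, hb, q, hq⟩ := exists_prime_mul_eq_two_mul_add_one hs
  have hp0 : (0 : ℤ) < p := mod_cast hp.pos
  have hdvd (t : ℤ) (ht : (t : ZMod p) = q) : (p : ℤ) ∣ t ^ 2 + b := by
    rw [← ZMod.intCast_zmod_eq_zero_iff_dvd]
    push_cast at hq ⊢
    rw [ht]
    linear_combination -hq
  -- Since `p` and `b` are odd, the root of `-b` modulo `p` can be taken odd.
  obtain ⟨r, hr, hro⟩ : ∃ r : ℤ, (p : ℤ) ∣ r ^ 2 + b ∧ Odd r := by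
    obtain ⟨t, ht⟩ := ZMod.intCast_surjective q
    rcases Int.even_or_odd t with he | ho
    · exact ⟨t + p, hdvd _ (by simp [ht]), he.add_odd (by exact_mod_cast Nat.odd_iff.mpr hp2)⟩
    · exact ⟨t, hdvd t ht, ho⟩
  have h2 : (2 : ℤ) ∣ r ^ 2 + b :=
    (hro.pow.add_odd (by exact_mod_cast Nat.odd_iff.mpr hb)).two_dvd
  have hcop : IsCoprime (2 : ℤ) p := by
    have := Nat.coprime_two_left.mpr (Nat.odd_iff.mpr hp2)
    exact_mod_cast Nat.isCoprime_iff_coprime.mpr this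
  obtain ⟨a, ha⟩ := hcop.mul_dvd h2 hr
  have hbs' : (b * s : ℤ) = 2 * p + 1 := mod_cast hbs
  have hb0 : (0 : ℤ) < b := by omega
  have h : UnimodularTernary s a (2 * p) s 0 1 r :=
    { pos := by
        by_contra hneg
        nlinarith [sq_nonneg r]
      minor_pos := by linarith
      det_eq := by linear_combination hbs' - s * ha
      represents := ⟨0, 0, 1, by ring⟩ }
  exact h.sum_three_sq

/-! ### Sums of two squares and four times a triangular number -/

/-- Both representations correspond to each other under `x = l + m`, `y = l - m`, `z = 2 n + 1`. -/
theorem exists_sq_add_sq_add_four_mul_triangularNumber_iff (N : ℤ) :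
    (∃ l m n : ℤ, N = l ^ 2 + m ^ 2 + 4 * triangularNumber n) ↔
      ∃ x y z : ℤ, x ^ 2 + y ^ 2 + z ^ 2 = 2 * N + 1 := by
  constructor
  · rintro ⟨l, m, n, h⟩
    exact ⟨l + m, l - m, 2 * n + 1,
      by linear_combination -2 * h - 4 * two_mul_triangularNumber n⟩
  · rintro ⟨x, y, z, h⟩
    have key (x y z : ℤ) (h : x ^ 2 + y ^ 2 + z ^ 2 = 2 * N + 1) (hz : Odd z) :
        ∃ l m n : ℤ, N = l ^ 2 + m ^ 2 + 4 * triangularNumber n := by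
      have hxy : Even (x + y) := by
        have : Odd (x ^ 2 + y ^ 2 + z ^ 2) := h ▸ odd_two_mul_add_one N
        simp only [Int.odd_add, Int.even_pow] at this
        grind
      obtain ⟨l, hl⟩ := hxy
      obtain ⟨n, rfl⟩ := hz
      obtain rfl : x = 2 * l - y := by linarith
      refine ⟨l, l - y, n, ?_⟩
      linarith [two_mul_triangularNumber n]
    -- The sum is odd, so one of the three squares is odd, and it may serve as the last one.
    by_cases hz : Odd z
    · exact key x y z h hz
    by_cases hy : Odd y
    · exact key x z y (by linarith) hy
    · refine key y z x (by linarith) ?_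
      by_contra hx
      rw [Int.not_odd_iff_even] at hx hy hz
      have : Even (x ^ 2 + y ^ 2 + z ^ 2) := by simp [hx, hy, hz, parity_simps]
      rw [h] at this
      exact Int.not_even_iff_odd.mpr (odd_two_mul_add_one N) this

theorem sum_three_sq_emod_eight_ne_seven (x y z : ℤ) : (x ^ 2 + y ^ 2 + z ^ 2) % 8 ≠ 7 := by
  intro h
  have key : ∀ x y z : ZMod 8, x ^ 2 + y ^ 2 + z ^ 2 ≠ 7 := by decide
  apply key x y z
  have := (ZMod.intCast_eq_intCast_iff' (x ^ 2 + y ^ 2 + z ^ 2) 7 8).mpr h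
  simpa using this

theorem mainTheorem12 (N : ℕ) :
    (∃ l m n : ℤ, (N : ℤ) = l ^ 2 + m ^ 2 + 4 * triangularNumber n) ↔
      ¬ ∃ k : ℕ, N = 4 * k + 3 := by
  rw [exists_sq_add_sq_add_four_mul_triangularNumber_iff]
  constructor
  · rintro ⟨x, y, z, h⟩ ⟨k, rfl⟩
    apply sum_three_sq_emod_eight_ne_seven x y z
    rw [h]
    push_cast
    omega
  · intro h
    have hN : N % 4 ≠ 3 := fun h3 => h ⟨N / 4, by omega⟩
    simpa using sum_three_sq_of_odd (s := 2 * N + 1) (by omega)
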